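/- **Setting.** A signature $\Omega$ consists of function symbols $f$ and real-valued relation symbols $\mathcal R$, each of a finite arity $m\ge 0$, and, for every symbol $s$, of a positive rational $\delta(s,N,\epsilon)$ for each positive integer $N$ and each positive rational $\epsilon$, and a non-negative integer $K(s,N)$ for each integer $N\ge 0$. An $\Omega$-structure is a real normed space $E$ with functions $f:E^m\to E$ and $\mathcal R:E^m\to\mathbb R$ interpreting the symbols such that for every symbol $s$ (with $|\cdot|$ in place of $\|\cdot\|$ for values of relations): if $\|x_k\|,\|y_k\|<N$ and $\|x_k-y_k\|<\delta(s,N,\epsilon)$ for all $k$, then $\|s(\vec x)-s(\vec y)\|\le\epsilon$; and if $\|x_k\|\le N$ for all $k$, then $\|s(\vec x)\|\le K(s,N)$. Terms are built from variables, $0$, $+$, multiplication by rational scalars and the function symbols. The formulas of $L_{PB}$ are built from the atomic formulas $\|t\|\le r$, $\|t\|\ge r$, $\mathcal R(\vec t)\le r$, $\mathcal R(\vec t)\ge r$ ($r\in\mathbb Q$) by $\wedge$, $\vee$, countable conjunction $\bigwedge_{i=1}^\infty$, and the bounded quantifiers $\exists y(\|y\|\le r\wedge\phi)$ and $\forall y(\|y\|\le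 r\Rightarrow\phi)$ with $r\in\mathbb Q$; satisfaction $E\models\phi$ is the usual one. For a positive integer $n$ the approximation $\phi_n$ is defined by: $(\|t\|\le r)_n$ is $\|t\|\le r+\frac1n$ and $(\|t\|\ge r)_n$ is $\|t\|\ge r-\frac1n$, likewise for $\mathcal R$; $(\phi\wedge\psi)_n=\phi_n\wedge\psi_n$; $(\phi\vee\psi)_n=\phi_n\vee\psi_n$; $(\bigwedge_{i=1}^\infty\phi_i)_n=\bigwedge_{i=1}^n(\phi_i)_n$; $(\exists y(\|y\|\le r\wedge\phi))_n=\exists y(\|y\|\le r+\frac1n\wedge\phi_n)$; $(\forall y(\|y\|\le r\Rightarrow\phi))_n=\forall y(\|y\|\le r-\frac1n\Rightarrow\phi_n)$. For a set $\Sigma$ of $L_{PB}$ sentences, $\Sigma\models(\phi\Rightarrow\psi)$ means that every $\Omega$-structure in which all sentences of $\Sigma$ are true and $\phi$ is true satisfies $\psi$. **Corollary ("Almost" versions).** Let $\Omega$ be a signature, $\Sigma$ a set of $L_{PB}$ sentences, and $\sigma,\theta$ sentences of $L_{PB}$, where no universal quantifier of $\sigma$ has bound $r=0$. If $\Sigma\models(\sigma\Rightarrow\theta)$,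 then for every positive integer $n$ there is a positive integer $m$ such that $\Sigma\models(\sigma_m\Rightarrow\theta_n)$. -/

import Mathlib

universe u v

/-- Positive rationals. -/
abbrev PosRat : Type := {q : ℚ // 0 < q}

/-- A signature for normed space structures: function symbols and real-valued relation symbols with
their arities (a constant is a `0`-ary function symbol), together with a modulus of uniform
continuity on each bounded set and a bound on each bounded set for every symbol. -/
structure NSignature : Type (u + 1) where
  Fn : Type u
  Rel : Type u
  fnArity : Fn → ℕ
  relArity : Rel → ℕ
  fnMod : Fn → ℕ+ → PosRat → PosRat
  relMod : Rel → ℕ+ → PosRat → PosRat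
  fnBound : Fn → ℕ → ℕ
  relBound : Rel → ℕ → ℕ

/-- A normed space structure of signature `Ω`: a real normed space with an interpretation of each
symbol that obeys the moduli and the bounds that the signature prescribes. -/
structure NStructure (Ω : NSignature.{u}) : Type (max u (v + 1)) where
  carrier : Type v
  [normed : NormedAddCommGroup carrier]
  [space : NormedSpace ℝ carrier]
  fn : (f : Ω.Fn) → (Fin (Ω.fnArity f) → carrier) → carrier
  rel : (R : Ω.Rel) → (Fin (Ω.relArity R) → carrier) → ℝ
  fn_mod : ∀ (f : Ω.Fn) (N : ℕ+) (ε : PosRat) (x y : Fin (Ω.fnArity f) → carrier),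
    (∀ k, ‖x k‖ < (N : ℕ) ∧ ‖y k‖ < (N : ℕ) ∧ ‖x k - y k‖ < ((Ω.fnMod f N ε : ℚ) : ℝ)) →
      ‖fn f x - fn f y‖ ≤ ((ε : ℚ) : ℝ)
  rel_mod : ∀ (R : Ω.Rel) (N : ℕ+) (ε : PosRat) (x y : Fin (Ω.relArity R) → carrier),
    (∀ k, ‖x k‖ < (N : ℕ) ∧ ‖y k‖ < (N : ℕ) ∧ ‖x k - y k‖ < ((Ω.relMod R N ε : ℚ) : ℝ)) →
      |rel R x - rel R y| ≤ ((ε : ℚ) : ℝ)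
  fn_bound : ∀ (f : Ω.Fn) (N : ℕ) (x : Fin (Ω.fnArity f) → carrier),
    (∀ k, ‖x k‖ ≤ N) → ‖fn f x‖ ≤ Ω.fnBound f N
  rel_bound : ∀ (R : Ω.Rel) (N : ℕ) (x : Fin (Ω.relArity R) → carrier),
    (∀ k, ‖x k‖ ≤ N) → |rel R x| ≤ Ω.relBound R N

attribute [instance] NStructure.normed NStructure.space

/-- Terms, with free variables among `x₀, …, xₖ₋₁`, of the first-order language of `Ω`: built with
`0`, `+`, multiplication by rational scalars and the function symbols of `Ω`. -/
inductive NTerm (Ω : NSignature.{u}) (k : ℕ) : Type u where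
  | var (i : Fin k) : NTerm Ω k
  | zero : NTerm Ω k
  | add (s t : NTerm Ω k) : NTerm Ω k
  | smul (q : ℚ) (t : NTerm Ω k) : NTerm Ω k
  | app (f : Ω.Fn) (t : Fin (Ω.fnArity f) → NTerm Ω k) : NTerm Ω k

/-- Formulas of `L_PB` with free variables among `x₀, …, xₖ₋₁`. A quantifier binds the variable
`x₀` of its body, the other variables being shifted by one.  Rational bounds of quantifiers may have
any sign, so that the approximations below (which lower the bounds of universal quantifiers)
stay inside the language.  -/
inductive PBFormula (Ω : NSignature.{u}) : ℕ → Type u where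
  /-- `‖t‖ ≤ r` -/
  | normLE {k : ℕ} (t : NTerm Ω k) (r : ℚ) : PBFormula Ω k
  /-- `‖t‖ ≥ r` -/
  | normGE {k : ℕ} (t : NTerm Ω k) (r : ℚ) : PBFormula Ω k
  /-- `R(t₁, …, tₘ) ≤ r` -/
  | relLE {k : ℕ} (R : Ω.Rel) (t : Fin (Ω.relArity R) → NTerm Ω k) (r : ℚ) : PBFormula Ω k
  /-- `R(t₁, …, tₘ) ≥ r` -/
  | relGE {k : ℕ} (R : Ω.Rel) (t : Fin (Ω.relArity R) → NTerm Ω k) (r : ℚ) : PBFormula Ω k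
  | and {k : ℕ} (φ ψ : PBFormula Ω k) : PBFormula Ω k
  | or {k : ℕ} (φ ψ : PBFormula Ω k) : PBFormula Ω k
  /-- The countable conjunction of `φ 0, φ 1, φ 2, …` -/
  | iAnd {k : ℕ} (φ : ℕ → PBFormula Ω k) : PBFormula Ω k
  /-- `∃ y (‖y‖ ≤ r ∧ φ(y, x))` -/
  | ex {k : ℕ} (r : ℚ) (φ : PBFormula Ω (k + 1)) : PBFormula Ω k
  /-- `∀ y (‖y‖ ≤ r ⇒ φ(y, x))` -/
  | all {k : ℕ} (r : ℚ) (φ : PBFormula Ω (k + 1)) : PBFormula Ω k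

/-- Sentences of `L_PB`. -/
abbrev PBSentence (Ω : NSignature.{u}) : Type u := PBFormula Ω 0

namespace PBFormula

/-- The conjunction of the `n + 1` formulas `φ 0, …, φ n`. -/
def finAnd {Ω : NSignature.{u}} {k : ℕ} (φ : ℕ → PBFormula Ω k) : ℕ → PBFormula Ω k
  | 0 => φ 0
  | n + 1 => and (finAnd φ n) (φ (n + 1))

/-- The approximation `φₙ` of `φ`, for positive integers `n`. (A countable conjunction is replaced
by the conjunction of the approximations of its first `n` members, which are numbered from `0`.) -/
def approx {Ω : NSignature.{u}} : {k : ℕ} → PBFormula Ω k → ℕ → PBFormula Ω k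
  | _, normLE t r, n => normLE t (r + 1 / (n : ℚ))
  | _, normGE t r, n => normGE t (r - 1 / (n : ℚ))
  | _, relLE R t r, n => relLE R t (r + 1 / (n : ℚ))
  | _, relGE R t r, n => relGE R t (r - 1 / (n : ℚ))
  | _, and φ ψ, n => and (φ.approx n) (ψ.approx n)
  | _, or φ ψ, n => or (φ.approx n) (ψ.approx n)
  | _, iAnd φ, n => finAnd (fun i => (φ i).approx n) (n - 1)
  | _, ex r φ, n => ex (r + 1 / (n : ℚ)) (φ.approx n)
  | _, all r φ, n => all (r - 1 / (n : ℚ)) (φ.approx n)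

/-- No universal quantifier of the formula has bound `0`. -/
def UnivBoundsNeZero {Ω : NSignature.{u}} : {k : ℕ} → PBFormula Ω k → Prop
  | _, normLE _ _ => True
  | _, normGE _ _ => True
  | _, relLE _ _ _ => True
  | _, relGE _ _ _ => True
  | _, and φ ψ => φ.UnivBoundsNeZero ∧ ψ.UnivBoundsNeZero
  | _, or φ ψ => φ.UnivBoundsNeZero ∧ ψ.UnivBoundsNeZero
  | _, iAnd φ => ∀ i, (φ i).UnivBoundsNeZero
  | _, ex _ φ => φ.UnivBoundsNeZero
  | _, all r φ => r ≠ 0 ∧ φ.UnivBoundsNeZero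

end PBFormula

namespace NStructure

/-- The value of a term in a structure. -/
noncomputable def eval {Ω : NSignature.{u}} (E : NStructure.{u, v} Ω) {k : ℕ}
    (a : Fin k → E.carrier) : NTerm Ω k → E.carrier
  | .var i => a i
  | .zero => 0
  | .add s t => E.eval a s + E.eval a t
  | .smul q t => (q : ℝ) • E.eval a t
  | .app f t => E.fn f (fun i => E.eval a (t i))

/-- Satisfaction `E ⊨ φ(a)`. -/
def Sat {Ω : NSignature.{u}} (E : NStructure.{u, v} Ω) :
    {k : ℕ} → PBFormula Ω k → (Fin k → E.carrier) → Prop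
  | _, .normLE t r, a => ‖E.eval a t‖ ≤ (r : ℝ)
  | _, .normGE t r, a => (r : ℝ) ≤ ‖E.eval a t‖
  | _, .relLE R t r, a => E.rel R (fun i => E.eval a (t i)) ≤ (r : ℝ)
  | _, .relGE R t r, a => (r : ℝ) ≤ E.rel R (fun i => E.eval a (t i))
  | _, .and φ ψ, a => E.Sat φ a ∧ E.Sat ψ a
  | _, .or φ ψ, a => E.Sat φ a ∨ E.Sat ψ a
  | _, .iAnd φ, a => ∀ i, E.Sat (φ i) a
  | _, .ex r φ, a => ∃ y : E.carrier, ‖y‖ ≤ (r : ℝ) ∧ E.Sat φ (Matrix.vecCons y a)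
  | _, .all r φ, a => ∀ y : E.carrier, ‖y‖ ≤ (r : ℝ) → E.Sat φ (Matrix.vecCons y a)

/-- `E ⊨ φ` for a sentence `φ`. -/
def Holds {Ω : NSignature.{u}} (E : NStructure.{u, v} Ω) (φ : PBSentence Ω) : Prop :=
  E.Sat φ ![]

/-- `E` is a model of the theory `T`. -/
def IsModel {Ω : NSignature.{u}} (E : NStructure.{u, v} Ω) (T : Set (PBSentence Ω)) : Prop :=
  ∀ φ ∈ T, E.Holds φ

end NStructure

/-- `T ⊨ (φ ⇒ ψ)`, the implication being the classical one, `¬ (φ ∧ ¬ ψ)`: it holds in every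
normed space structure that is a model of `T`. -/
def EntailsImp {Ω : NSignature.{u}} (T : Set (PBSentence Ω)) (φ ψ : PBSentence Ω) : Prop :=
  ∀ E : NStructure.{u, v} Ω, E.IsModel T → ¬ (E.Holds φ ∧ ¬ E.Holds ψ)

/-! The proof is a compactness argument by ultraproducts. If the conclusion fails for `n`, then for
each `i` some model `F i` of `T` satisfies `σ.approx (i + 1)` but not `θ.approx n`. Let `E` be the
ultraproduct of the `F i` along a nonprincipal ultrafilter: bounded sequences modulo those whose
norms tend to 0. The prescribed moduli and bounds are uniform in `i`, so they make the symbols well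
defined on classes and survive in the limit.

Three one-way transfers replace Łoś's theorem. Truth in almost all factors passes to `E`
(`sat_ultraprod_of_eventually_sat`), so `E` is a model of `T`. If every approximation holds in
almost all factors, the formula holds in `E` (`sat_ultraprod_of_eventually_sat_approx`), so `E`
satisfies `σ`, hence `θ`. A formula true in `E` has each approximation true in almost all factors
(`eventually_sat_approx_of_sat_ultraprod`), so some `F i` satisfies `θ.approx n`, a contradiction.
-/

open Filter Topology

namespace NStructure

variable {Ω : NSignature.{u}}

/-! ### Bounded sequences, seminormed by the limit of the norms along an ultrafilter -/

/-- The bounded sequences in a sequence of structures, as a submodule of the product. -/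
def bddSubmodule (F : ℕ → NStructure.{u, v} Ω) : Submodule ℝ (∀ i, (F i).carrier) where
  carrier := {a | ∃ C : ℝ, ∀ i, ‖a i‖ ≤ C}
  zero_mem' := ⟨0, fun i => by simp⟩
  add_mem' := by
    rintro a b ⟨C, hC⟩ ⟨D, hD⟩
    exact ⟨C + D, fun i => (norm_add_le _ _).trans (add_le_add (hC i) (hD i))⟩
  smul_mem' := by
    rintro c a ⟨C, hC⟩
    refine ⟨‖c‖ * C, fun i => ?_⟩
    simp only [Pi.smul_apply, norm_smul]
    exact mul_le_mul_of_nonneg_left (hC i) (norm_nonneg c)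

/-- The space of bounded sequences, to be seminormed by means of the ultrafilter `U`. -/
def BddSeq (_U : Ultrafilter ℕ) (F : ℕ → NStructure.{u, v} Ω) : Type v :=
  bddSubmodule F

variable {U : Ultrafilter ℕ} {F : ℕ → NStructure.{u, v} Ω}

namespace BddSeq

noncomputable instance : AddCommGroup (BddSeq U F) :=
  inferInstanceAs (AddCommGroup (bddSubmodule F))

noncomputable instance : Module ℝ (BddSeq U F) :=
  inferInstanceAs (Module ℝ (bddSubmodule F))

/-- The `i`-th entry of a bounded sequence. -/
def get (a : BddSeq U F) (i : ℕ) : (F i).carrier := a.1 i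

/-- The bounded sequence with given entries. -/
def ofBdd (U : Ultrafilter ℕ) (a : ∀ i, (F i).carrier) (h : ∃ C : ℝ, ∀ i, ‖a i‖ ≤ C) :
    BddSeq U F := ⟨a, h⟩

@[simp] lemma get_zero (i : ℕ) : (0 : BddSeq U F).get i = 0 := rfl

@[simp] lemma get_add (a b : BddSeq U F) (i : ℕ) : (a + b).get i = a.get i + b.get i := rfl

@[simp] lemma get_neg (a : BddSeq U F) (i : ℕ) : (-a).get i = -a.get i := rfl

@[simp] lemma get_smul (c : ℝ) (a : BddSeq U F) (i : ℕ) : (c • a).get i = c • a.get i := rfl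

lemma exists_bound (a : BddSeq U F) : ∃ C : ℝ, ∀ i, ‖a.get i‖ ≤ C := a.2

end BddSeq

/-- A bounded real sequence converges along an ultrafilter to its `limUnder`. -/
lemma tendsto_limUnder_of_bdd (U : Ultrafilter ℕ) {f : ℕ → ℝ} (h : ∃ C : ℝ, ∀ i, |f i| ≤ C) :
    Tendsto f U (𝓝 (limUnder (U : Filter ℕ) f)) := by
  obtain ⟨C, hC⟩ := h
  obtain ⟨L, -, hL⟩ := (isCompact_Icc (a := -C) (b := C)).ultrafilter_le_nhds (U.map f)
    (le_principal_iff.2 (Ultrafilter.mem_map.2 (Filter.univ_mem' fun i => abs_le.1 (hC i))))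
  exact tendsto_nhds_limUnder ⟨L, hL⟩

namespace BddSeq

noncomputable instance : Norm (BddSeq U F) :=
  ⟨fun a => limUnder (U : Filter ℕ) fun i => ‖a.get i‖⟩

lemma tendsto_norm (a : BddSeq U F) : Tendsto (fun i => ‖a.get i‖) U (𝓝 ‖a‖) :=
  tendsto_limUnder_of_bdd U (by simpa using a.exists_bound)

lemma norm_eq_of_tendsto {a : BddSeq U F} {L : ℝ}
    (h : Tendsto (fun i => ‖a.get i‖) U (𝓝 L)) : ‖a‖ = L :=
  tendsto_nhds_unique a.tendsto_norm h

noncomputable instance : SeminormedAddCommGroup (BddSeq U F) :=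
  AddGroupSeminorm.toSeminormedAddCommGroup
    { toFun := fun a => ‖a‖
      map_zero' := norm_eq_of_tendsto (by simp)
      add_le' := fun a b => le_of_tendsto_of_tendsto' (tendsto_norm (a + b))
        (a.tendsto_norm.add b.tendsto_norm) fun i => norm_add_le _ _
      neg' := fun a => norm_eq_of_tendsto (by simpa using a.tendsto_norm) }

noncomputable instance : NormedSpace ℝ (BddSeq U F) where
  norm_smul_le c a := le_of_eq <| norm_eq_of_tendsto <| by
    simpa [norm_smul] using a.tendsto_norm.const_mul ‖c‖

end BddSeq

/-- The carrier of the ultraproduct. -/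
abbrev UltraCarrier (U : Ultrafilter ℕ) (F : ℕ → NStructure.{u, v} Ω) : Type v :=
  SeparationQuotient (BddSeq U F)

namespace BddSeq

/-- The class of a bounded sequence in the ultraproduct. -/
noncomputable def cls (a : BddSeq U F) : UltraCarrier U F := SeparationQuotient.mk a

/-- A representative of an element of the ultraproduct. -/
noncomputable def rep (x : UltraCarrier U F) : BddSeq U F :=
  Function.surjInv SeparationQuotient.surjective_mk x

@[simp] lemma cls_rep (x : UltraCarrier U F) : cls (rep x) = x :=
  Function.surjInv_eq SeparationQuotient.surjective_mk x

@[simp] lemma norm_cls (a : BddSeq U F) : ‖cls a‖ = ‖a‖ := SeparationQuotient.norm_mk a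

lemma cls_sub (a b : BddSeq U F) : cls (a - b) = cls a - cls b := rfl

lemma cls_eq_iff {a b : BddSeq U F} :
    cls a = cls b ↔ Tendsto (fun i => ‖a.get i - b.get i‖) U (𝓝 0) := by
  rw [← sub_eq_zero, ← cls_sub, ← norm_eq_zero, norm_cls]
  exact ⟨fun h => h ▸ tendsto_norm (a - b), fun h => norm_eq_of_tendsto (a := a - b) h⟩

end BddSeq

/-! ### Representatives and witnesses with controlled norms -/

/-- Every vector `y` can be moved into the ball of radius `r` by at most `max 0 (‖y‖ - r)`. -/
lemma exists_truncation {V : Type*} [NormedAddCommGroup V] [NormedSpace ℝ V] (y : V) {r : ℝ}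
    (hr : 0 ≤ r) : ∃ z : V, ‖z‖ ≤ r ∧ ‖y - z‖ ≤ max 0 (‖y‖ - r) := by
  rcases le_or_gt ‖y‖ r with h | h
  · exact ⟨y, h, by simp⟩
  · have hy : 0 < ‖y‖ := hr.trans_lt h
    refine ⟨(r / ‖y‖) • y, ?_, ?_⟩
    · rw [norm_smul, Real.norm_of_nonneg (by positivity), div_mul_cancel₀ _ hy.ne']
    · have h1 : y - (r / ‖y‖) • y = (1 - r / ‖y‖) • y := by rw [sub_smul, one_smul]
      have h2 : 0 ≤ 1 - r / ‖y‖ := sub_nonneg.2 ((div_le_one hy).2 h.le)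
      rw [h1, norm_smul, Real.norm_of_nonneg h2, sub_mul, div_mul_cancel₀ _ hy.ne', one_mul]
      exact le_max_right _ _

namespace BddSeq

/-- If `r i` tends to `r ≥ ‖a‖` then `a` is equivalent to a sequence with `‖b i‖ ≤ r i` wherever
`r i` is nonnegative. -/
lemma exists_cls_eq_norm_le (a : BddSeq U F) {r : ℕ → ℝ} {s : ℝ} (hr : ∀ᶠ i in U, 0 ≤ r i)
    (hs : Tendsto r U (𝓝 s)) (ha : ‖a‖ ≤ s) :
    ∃ b : BddSeq U F, cls b = cls a ∧ ∀ i, 0 ≤ r i → ‖b.get i‖ ≤ r i := by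
  classical
  -- The bound `2 * ‖a.get i‖` is imposed at every index, to keep the new sequence bounded even
  -- where `r i` is negative.
  have key : ∀ i, ∃ z : (F i).carrier, ‖z‖ ≤ 2 * ‖a.get i‖ ∧ (0 ≤ r i → ‖z‖ ≤ r i ∧
      ‖a.get i - z‖ ≤ max 0 (‖a.get i‖ - r i)) := by
    intro i
    by_cases hi : 0 ≤ r i
    · obtain ⟨z, hz, hz'⟩ := exists_truncation (a.get i) hi
      refine ⟨z, ?_, fun _ => ⟨hz, hz'⟩⟩
      have h1 : ‖z‖ ≤ ‖a.get i‖ + ‖a.get i - z‖ := by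
        simpa using norm_sub_le (a.get i) (a.get i - z)
      have h2 : max 0 (‖a.get i‖ - r i) ≤ ‖a.get i‖ := max_le (norm_nonneg _) (by linarith)
      linarith
    · exact ⟨0, by simp, fun h => absurd h hi⟩
  choose z hz hz' using key
  obtain ⟨C, hC⟩ := a.exists_bound
  refine ⟨ofBdd U z ⟨2 * C, fun i => (hz i).trans (by linarith [hC i])⟩, ?_,
    fun i hi => (hz' i hi).1⟩
  refine (cls_eq_iff.2 ?_).symm
  have hlim : Tendsto (fun i => max 0 (‖a.get i‖ - r i)) U (𝓝 0) := by
    have := (tendsto_const_nhds (x := (0 : ℝ))).max (a.tendsto_norm.sub hs)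
    rwa [max_eq_left (sub_nonpos.2 ha)] at this
  refine squeeze_zero' (Eventually.of_forall fun i => norm_nonneg _) ?_ hlim
  filter_upwards [hr] with i hi using (hz' i hi).2

/-- A representative chosen arbitrarily meets the bound only in the limit; truncation makes it exact
in every factor, as the bounds of the symbols and the universal quantifiers demand. -/
lemma exists_rep_norm_le {x : UltraCarrier U F} {r : ℝ} (hx : ‖x‖ ≤ r) :
    ∃ a : BddSeq U F, cls a = x ∧ ∀ i, ‖a.get i‖ ≤ r := by
  have hr : 0 ≤ r := (norm_nonneg x).trans hx
  obtain ⟨b, hb, hb'⟩ := exists_cls_eq_norm_le (rep x) (r := fun _ => r)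
    (Eventually.of_forall fun _ => hr) tendsto_const_nhds (by rwa [← norm_cls, cls_rep])
  exact ⟨b, by rw [hb, cls_rep], fun i => hb' i hr⟩

/-- Eventual bounded choice of witnesses. -/
lemma exists_forall_eventually {P : ∀ i, (F i).carrier → Prop} {C : ℝ}
    (h : ∀ᶠ i in U, ∃ y, ‖y‖ ≤ C ∧ P i y) :
    ∃ b : BddSeq U F, ∀ᶠ i in U, ‖b.get i‖ ≤ C ∧ P i (b.get i) := by
  have key : ∀ i, ∃ y : (F i).carrier, ‖y‖ ≤ max C 0 ∧
      ((∃ y, ‖y‖ ≤ C ∧ P i y) → ‖y‖ ≤ C ∧ P i y) := by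
    intro i
    by_cases hi : ∃ y, ‖y‖ ≤ C ∧ P i y
    · obtain ⟨y, hy, hP⟩ := hi
      exact ⟨y, hy.trans (le_max_left _ _), fun _ => ⟨hy, hP⟩⟩
    · exact ⟨0, by simp, fun h => absurd h hi⟩
  choose y hy hy' using key
  exact ⟨ofBdd U y ⟨_, hy⟩, h.mono fun i hi => hy' i hi⟩

/-! ### Symbols of the signature on bounded sequences -/

/-- Finitely many bounded sequences have a common bound. -/
lemma exists_nat_bound {m : ℕ} (a : Fin m → BddSeq U F) :
    ∃ N : ℕ, ∀ k i, ‖(a k).get i‖ ≤ N := by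
  choose C hC using fun k => (a k).exists_bound
  refine ⟨∑ k, ⌈C k⌉₊, fun k i => (hC k i).trans ((Nat.le_ceil _).trans ?_)⟩
  exact_mod_cast Finset.single_le_sum (f := fun k => ⌈C k⌉₊) (fun _ _ => Nat.zero_le _)
    (Finset.mem_univ k)

/-- The entrywise application of a function symbol. -/
def app (f : Ω.Fn) (a : Fin (Ω.fnArity f) → BddSeq U F) : BddSeq U F :=
  ofBdd U (fun i => (F i).fn f fun k => (a k).get i) <| by
    obtain ⟨N, hN⟩ := exists_nat_bound a
    exact ⟨_, fun i => (F i).fn_bound f N _ fun k => hN k i⟩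

@[simp] lemma get_app (f : Ω.Fn) (a : Fin (Ω.fnArity f) → BddSeq U F) (i : ℕ) :
    (app f a).get i = (F i).fn f fun k => (a k).get i := rfl

/-- The limit of the entrywise values of a relation symbol. -/
noncomputable def relLim (R : Ω.Rel) (a : Fin (Ω.relArity R) → BddSeq U F) : ℝ :=
  limUnder (U : Filter ℕ) fun i => (F i).rel R fun k => (a k).get i

lemma tendsto_relLim (R : Ω.Rel) (a : Fin (Ω.relArity R) → BddSeq U F) :
    Tendsto (fun i => (F i).rel R fun k => (a k).get i) U (𝓝 (relLim R a)) := by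
  obtain ⟨N, hN⟩ := exists_nat_bound a
  exact tendsto_limUnder_of_bdd U ⟨_, fun i => (F i).rel_bound R N _ fun k => hN k i⟩

lemma eventually_close {m : ℕ} {a b : Fin m → BddSeq U F} {N : ℝ} {δ : ℝ}
    (h : ∀ k, ‖a k‖ < N ∧ ‖b k‖ < N ∧ ‖a k - b k‖ < δ) :
    ∀ᶠ i in U, ∀ k, ‖(a k).get i‖ < N ∧ ‖(b k).get i‖ < N ∧ ‖(a k).get i - (b k).get i‖ < δ :=
  eventually_all.2 fun k => ((a k).tendsto_norm.eventually_lt_const (h k).1).and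
    (((b k).tendsto_norm.eventually_lt_const (h k).2.1).and
      ((a k - b k).tendsto_norm.eventually_lt_const (h k).2.2))

lemma norm_app_sub_app_le (f : Ω.Fn) (N : ℕ+) (ε : PosRat)
    {a b : Fin (Ω.fnArity f) → BddSeq U F}
    (h : ∀ k, ‖a k‖ < (N : ℕ) ∧ ‖b k‖ < (N : ℕ) ∧ ‖a k - b k‖ < ((Ω.fnMod f N ε : ℚ) : ℝ)) :
    ‖app f a - app f b‖ ≤ ((ε : ℚ) : ℝ) :=
  le_of_tendsto (tendsto_norm (app f a - app f b))
    ((eventually_close h).mono fun i hi => (F i).fn_mod f N ε _ _ hi)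

lemma abs_relLim_sub_relLim_le (R : Ω.Rel) (N : ℕ+) (ε : PosRat)
    {a b : Fin (Ω.relArity R) → BddSeq U F}
    (h : ∀ k, ‖a k‖ < (N : ℕ) ∧ ‖b k‖ < (N : ℕ) ∧ ‖a k - b k‖ < ((Ω.relMod R N ε : ℚ) : ℝ)) :
    |relLim R a - relLim R b| ≤ ((ε : ℚ) : ℝ) :=
  le_of_tendsto ((tendsto_relLim R a).sub (tendsto_relLim R b)).abs
    ((eventually_close h).mono fun i hi => (F i).rel_mod R N ε _ _ hi)

/-- One `N` serves all `δ`, so equivalent tuples satisfy the modulus hypothesis for every `ε` at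
once; this gives independence of representatives. -/
lemma exists_pnat_norm_lt {m : ℕ} {a b : Fin m → BddSeq U F} (h : ∀ k, cls (a k) = cls (b k)) :
    ∃ N : ℕ+, ∀ δ : ℝ, 0 < δ →
      ∀ k, ‖a k‖ < (N : ℕ) ∧ ‖b k‖ < (N : ℕ) ∧ ‖a k - b k‖ < δ := by
  have hab : ∀ k, ‖a k‖ = ‖b k‖ := fun k => by rw [← norm_cls, h k, norm_cls]
  obtain ⟨N, hN⟩ := exists_nat_bound a
  have ha : ∀ k, ‖a k‖ < ((N + 1 : ℕ) : ℝ) := fun k =>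
    (le_of_tendsto' (a k).tendsto_norm (hN k)).trans_lt (by exact_mod_cast Nat.lt_succ_self N)
  refine ⟨⟨N + 1, N.succ_pos⟩, fun δ hδ k => ⟨ha k, hab k ▸ ha k, ?_⟩⟩
  rwa [← norm_cls, cls_sub, h k, sub_self, norm_zero]

lemma eq_zero_of_le_posRat {x : ℝ} (hx : 0 ≤ x) (h : ∀ ε : PosRat, x ≤ ((ε : ℚ) : ℝ)) :
    x = 0 := by
  by_contra hne
  obtain ⟨q, hq, hq'⟩ := exists_rat_btwn (lt_of_le_of_ne hx (Ne.symm hne))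
  exact absurd (h ⟨q, by exact_mod_cast hq⟩) (not_le.2 hq')

lemma cls_app_congr (f : Ω.Fn) {a b : Fin (Ω.fnArity f) → BddSeq U F}
    (h : ∀ k, cls (a k) = cls (b k)) : cls (app f a) = cls (app f b) := by
  obtain ⟨N, hN⟩ := exists_pnat_norm_lt h
  rw [← sub_eq_zero, ← cls_sub, ← norm_eq_zero, norm_cls]
  exact eq_zero_of_le_posRat (norm_nonneg _) fun ε => norm_app_sub_app_le f N ε
    (hN _ (by exact_mod_cast (Ω.fnMod f N ε).2))

lemma relLim_congr (R : Ω.Rel) {a b : Fin (Ω.relArity R) → BddSeq U F}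
    (h : ∀ k, cls (a k) = cls (b k)) : relLim R a = relLim R b := by
  obtain ⟨N, hN⟩ := exists_pnat_norm_lt h
  rw [← sub_eq_zero, ← abs_eq_zero]
  exact eq_zero_of_le_posRat (abs_nonneg _) fun ε => abs_relLim_sub_relLim_le R N ε
    (hN _ (by exact_mod_cast (Ω.relMod R N ε).2))

lemma norm_rep (x : UltraCarrier U F) : ‖rep x‖ = ‖x‖ := by rw [← norm_cls, cls_rep]

lemma norm_rep_sub_rep (x y : UltraCarrier U F) : ‖rep x - rep y‖ = ‖x - y‖ := by
  rw [← norm_cls, cls_sub, cls_rep, cls_rep]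

end BddSeq

/-! ### The ultraproduct structure and evaluation of terms -/

open BddSeq

/-- The ultraproduct of a sequence of structures. -/
noncomputable def ultraprod (U : Ultrafilter ℕ) (F : ℕ → NStructure.{u, v} Ω) :
    NStructure.{u, v} Ω where
  carrier := UltraCarrier U F
  fn f x := cls (app f fun k => rep (x k))
  rel R x := relLim R fun k => rep (x k)
  fn_mod f N ε x y h := by
    rw [← cls_sub, norm_cls]
    exact norm_app_sub_app_le f N ε (by simpa only [norm_rep, norm_rep_sub_rep] using h)
  rel_mod R N ε x y h :=
    abs_relLim_sub_relLim_le R N ε (by simpa only [norm_rep, norm_rep_sub_rep] using h)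
  fn_bound f N x h := by
    choose a ha hN using fun k => exists_rep_norm_le (h k)
    rw [cls_app_congr f (b := a) fun k => by rw [cls_rep, ha], norm_cls]
    exact le_of_tendsto' (tendsto_norm _) fun i => (F i).fn_bound f N _ fun k => hN k i
  rel_bound R N x h := by
    choose a ha hN using fun k => exists_rep_norm_le (h k)
    rw [relLim_congr R (b := a) fun k => by rw [cls_rep, ha]]
    exact le_of_tendsto' (tendsto_relLim R a).abs fun i =>
      (F i).rel_bound R N _ fun k => hN k i

/-- The class of a bounded sequence, as an element of the ultraproduct structure. -/
noncomputable def toUltra (a : BddSeq U F) : (ultraprod U F).carrier := cls a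

lemma exists_toUltra (x : (ultraprod U F).carrier) : ∃ a : BddSeq U F, toUltra a = x :=
  ⟨rep x, cls_rep x⟩

lemma norm_toUltra (a : BddSeq U F) : ‖toUltra a‖ = ‖a‖ := norm_cls a

lemma ultraprod_fn (f : Ω.Fn) (a : Fin (Ω.fnArity f) → BddSeq U F) :
    (ultraprod U F).fn f (fun k => toUltra (a k)) = toUltra (app f a) :=
  cls_app_congr f fun k => cls_rep (toUltra (a k))

lemma ultraprod_rel (R : Ω.Rel) (a : Fin (Ω.relArity R) → BddSeq U F) :
    (ultraprod U F).rel R (fun k => toUltra (a k)) = relLim R a :=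
  relLim_congr R fun k => cls_rep (toUltra (a k))

/-- Terms are evaluated entrywise in the ultraproduct. -/
lemma exists_eval_eq {k : ℕ} (a : Fin k → BddSeq U F) (t : NTerm Ω k) :
    ∃ b : BddSeq U F, (∀ i, b.get i = (F i).eval (fun j => (a j).get i) t) ∧
      (ultraprod U F).eval (fun j => toUltra (a j)) t = toUltra b := by
  induction t with
  | var j => exact ⟨a j, fun i => rfl, rfl⟩
  | zero => exact ⟨0, fun i => rfl, rfl⟩
  | add s t hs ht =>
    obtain ⟨b, hb, hb'⟩ := hs
    obtain ⟨c, hc, hc'⟩ := ht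
    refine ⟨b + c, fun i => by simp [eval, hb, hc], ?_⟩
    simp only [eval, hb', hc']
    rfl
  | smul q t ht =>
    obtain ⟨b, hb, hb'⟩ := ht
    refine ⟨(q : ℝ) • b, fun i => by simp [eval, hb], ?_⟩
    simp only [eval, hb']
    rfl
  | app f t ht =>
    choose b hb hb' using ht
    refine ⟨app f b, fun i => by simp [eval, hb], ?_⟩
    simp only [eval, hb', ultraprod_fn]

lemma tendsto_norm_eval {k : ℕ} (a : Fin k → BddSeq U F) (t : NTerm Ω k) :
    Tendsto (fun i => ‖(F i).eval (fun j => (a j).get i) t‖) U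
      (𝓝 ‖(ultraprod U F).eval (fun j => toUltra (a j)) t‖) := by
  obtain ⟨b, hb, hb'⟩ := exists_eval_eq a t
  simpa only [hb', norm_toUltra, ← hb] using b.tendsto_norm

lemma tendsto_rel_eval {k : ℕ} (a : Fin k → BddSeq U F) (R : Ω.Rel)
    (t : Fin (Ω.relArity R) → NTerm Ω k) :
    Tendsto (fun i => (F i).rel R fun l => (F i).eval (fun j => (a j).get i) (t l)) U
      (𝓝 ((ultraprod U F).rel R
        fun l => (ultraprod U F).eval (fun j => toUltra (a j)) (t l))) := by
  choose b hb hb' using fun l => exists_eval_eq a (t l)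
  simpa only [hb', ultraprod_rel, ← hb] using tendsto_relLim R b

lemma map_vecCons {α β : Type*} (g : α → β) {k : ℕ} (y : α) (a : Fin k → α) :
    (fun j => g (Matrix.vecCons y a j : α)) = Matrix.vecCons (g y) (fun j => g (a j)) := by
  funext j
  refine Fin.cases ?_ (fun j => ?_) j <;> simp

/-! ### Transfer of satisfaction -/

/-- Formulas true in almost all factors are true in the ultraproduct. -/
lemma sat_ultraprod_of_eventually_sat {k : ℕ} (φ : PBFormula Ω k) (a : Fin k → BddSeq U F)
    (h : ∀ᶠ i in U, (F i).Sat φ fun j => (a j).get i) :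
    (ultraprod U F).Sat φ fun j => toUltra (a j) := by
  induction φ with
  | normLE t r => exact le_of_tendsto (tendsto_norm_eval a t) h
  | normGE t r => exact ge_of_tendsto (tendsto_norm_eval a t) h
  | relLE R t r => exact le_of_tendsto (tendsto_rel_eval a R t) h
  | relGE R t r => exact ge_of_tendsto (tendsto_rel_eval a R t) h
  | and φ ψ hφ hψ => exact ⟨hφ a (h.mono fun i hi => hi.1), hψ a (h.mono fun i hi => hi.2)⟩
  | or φ ψ hφ hψ => exact (Ultrafilter.eventually_or.1 h).imp (hφ a) (hψ a)
  | iAnd φ hφ => exact fun n => hφ n a (h.mono fun i hi => hi n)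
  | ex r φ hφ =>
    obtain ⟨b, hb⟩ := exists_forall_eventually
      (P := fun i y => (F i).Sat φ (Matrix.vecCons y fun j => (a j).get i)) h
    refine ⟨toUltra b, (norm_toUltra b).trans_le
      (le_of_tendsto b.tendsto_norm (hb.mono fun i hi => hi.1)), ?_⟩
    rw [← map_vecCons toUltra]
    refine hφ _ (hb.mono fun i hi => ?_)
    rw [map_vecCons fun b : BddSeq U F => b.get i]
    exact hi.2
  | all r φ hφ =>
    intro y hy
    obtain ⟨b, rfl, hb⟩ := exists_rep_norm_le hy
    change (ultraprod U F).Sat φ (Matrix.vecCons (toUltra b) _)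
    rw [← map_vecCons toUltra]
    refine hφ _ (h.mono fun i hi => ?_)
    rw [map_vecCons fun b : BddSeq U F => b.get i]
    exact hi _ (hb i)

lemma sat_finAnd (E : NStructure.{u, v} Ω) {k : ℕ} (φ : ℕ → PBFormula Ω k) (n : ℕ)
    (a : Fin k → E.carrier) :
    E.Sat (PBFormula.finAnd φ n) a ↔ ∀ i ≤ n, E.Sat (φ i) a := by
  induction n with
  | zero => simp [PBFormula.finAnd]
  | succ n ih => simp only [PBFormula.finAnd, Sat, ih, Nat.le_succ_iff, or_imp, forall_and,
      forall_eq]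

/-- The approximations of a formula true in the ultraproduct are true in almost all factors. -/
lemma eventually_sat_approx_of_sat_ultraprod {n : ℕ} (hn : 0 < n) {k : ℕ} (φ : PBFormula Ω k)
    (a : Fin k → BddSeq U F) (h : (ultraprod U F).Sat φ fun j => toUltra (a j)) :
    ∀ᶠ i in U, (F i).Sat (φ.approx n) fun j => (a j).get i := by
  have hpos : (0 : ℝ) < 1 / n := by positivity
  induction φ with
  | normLE t r =>
    simp only [PBFormula.approx, Sat] at h ⊢
    push_cast
    exact (tendsto_norm_eval a t).eventually_le_const (by linarith)
  | normGE t r =>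
    simp only [PBFormula.approx, Sat] at h ⊢
    push_cast
    exact (tendsto_norm_eval a t).eventually_const_le (by linarith)
  | relLE R t r =>
    simp only [PBFormula.approx, Sat] at h ⊢
    push_cast
    exact (tendsto_rel_eval a R t).eventually_le_const (by linarith)
  | relGE R t r =>
    simp only [PBFormula.approx, Sat] at h ⊢
    push_cast
    exact (tendsto_rel_eval a R t).eventually_const_le (by linarith)
  | and φ ψ hφ hψ => exact (hφ a h.1).and (hψ a h.2)
  | or φ ψ hφ hψ => exact Ultrafilter.eventually_or.2 (Or.imp (hφ a) (hψ a) h)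
  | iAnd φ hφ =>
    simp only [PBFormula.approx, sat_finAnd]
    -- Only finitely many conjuncts survive in the approximation, and a finite intersection of large
    -- sets is large.
    exact (Set.finite_Iic (n - 1)).eventually_all.2 fun l _ => hφ l a (h l)
  | ex r φ hφ =>
    obtain ⟨y, hy, hsat⟩ := h
    obtain ⟨b, rfl, hb⟩ := exists_rep_norm_le hy
    change (ultraprod U F).Sat φ (Matrix.vecCons (toUltra b) _) at hsat
    rw [← map_vecCons toUltra] at hsat
    filter_upwards [hφ _ hsat] with i hi
    rw [map_vecCons fun b : BddSeq U F => b.get i] at hi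
    refine ⟨b.get i, ?_, hi⟩
    push_cast
    linarith [hb i]
  | all r φ hφ =>
    -- Counterexamples in almost all factors would form an element of the ball of radius `r` in the
    -- ultraproduct, where `φ` holds, against the induction hypothesis.
    by_contra hcon
    rw [← Ultrafilter.eventually_not] at hcon
    obtain ⟨b, hb⟩ := exists_forall_eventually (C := ((r - 1 / (n : ℚ) : ℚ) : ℝ))
      (P := fun i y => ¬ (F i).Sat (φ.approx n) (Matrix.vecCons y fun j => (a j).get i))
      (hcon.mono fun i hi => by simpa [PBFormula.approx, Sat] using hi)
    have hbr : ‖toUltra b‖ ≤ (r : ℝ) := by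
      rw [norm_toUltra]
      refine le_of_tendsto b.tendsto_norm (hb.mono fun i hi => hi.1.trans ?_)
      push_cast
      linarith
    have hsat := h _ hbr
    rw [← map_vecCons toUltra] at hsat
    obtain ⟨i, hi, hi'⟩ := ((hφ _ hsat).and hb).exists
    rw [map_vecCons fun b : BddSeq U F => b.get i] at hi
    exact hi'.2 hi

/-- Approximations become weaker as the index decreases. -/
lemma sat_approx_mono (E : NStructure.{u, v} Ω) {m n : ℕ} (hm : 0 < m) (hmn : m ≤ n) {k : ℕ}
    (φ : PBFormula Ω k) (a : Fin k → E.carrier) (h : E.Sat (φ.approx n) a) :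
    E.Sat (φ.approx m) a := by
  have hle : (1 : ℝ) / n ≤ 1 / m :=
    one_div_le_one_div_of_le (by exact_mod_cast hm) (by exact_mod_cast hmn)
  induction φ with
  | normLE t r => simp only [PBFormula.approx, Sat] at h ⊢; push_cast at h ⊢; linarith
  | normGE t r => simp only [PBFormula.approx, Sat] at h ⊢; push_cast at h ⊢; linarith
  | relLE R t r => simp only [PBFormula.approx, Sat] at h ⊢; push_cast at h ⊢; linarith
  | relGE R t r => simp only [PBFormula.approx, Sat] at h ⊢; push_cast at h ⊢; linarith
  | and φ ψ hφ hψ => exact ⟨hφ a h.1, hψ a h.2⟩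
  | or φ ψ hφ hψ => exact Or.imp (hφ a) (hψ a) h
  | iAnd φ hφ =>
    simp only [PBFormula.approx, sat_finAnd] at h ⊢
    exact fun i hi => hφ i a (h i (hi.trans (Nat.sub_le_sub_right hmn 1)))
  | ex r φ hφ =>
    obtain ⟨y, hy, hsat⟩ := h
    refine ⟨y, hy.trans ?_, hφ _ hsat⟩
    push_cast
    linarith
  | all r φ hφ =>
    intro y hy
    refine hφ _ (h y (hy.trans ?_))
    push_cast
    linarith

/-- Diagonalization along an ultrafilter that contains all final segments. -/
lemma exists_diagonal {U : Ultrafilter ℕ} (hU : (U : Filter ℕ) ≤ atTop) {P : ℕ → ℕ → Prop}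
    (h : ∀ n, 0 < n → ∀ᶠ i in U, P n i) :
    ∃ g : ℕ → ℕ, Tendsto g U atTop ∧ ∀ᶠ i in U, P (g i) i := by
  classical
  -- The cap `n ≤ i` makes a greatest `n` with `P n i` available; no monotonicity of `P` in `n` is
  -- needed.
  refine ⟨fun i => Nat.findGreatest (fun n => P n i) i, ?_, ?_⟩
  · refine tendsto_atTop.2 fun n => ?_
    filter_upwards [h (n + 1) n.succ_pos, hU (eventually_ge_atTop (n + 1))] with i hi hni
    exact n.le_succ.trans (Nat.le_findGreatest hni hi)
  -- Since `P 1 i` holds for almost all `i`, the value found is genuine and not the default 0.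
  · filter_upwards [h 1 one_pos, hU (eventually_ge_atTop 1)] with i hi hni
    exact Nat.findGreatest_spec (P := fun n => P n i) hni hi

/-- If every approximation of a formula is true in almost all factors then the formula is true in
the ultraproduct, provided that no universal quantifier has bound `0`. -/
lemma sat_ultraprod_of_eventually_sat_approx (hU : (U : Filter ℕ) ≤ atTop) {k : ℕ}
    (φ : PBFormula Ω k) (hφ0 : φ.UnivBoundsNeZero) (a : Fin k → BddSeq U F)
    (h : ∀ n, 0 < n → ∀ᶠ i in U, (F i).Sat (φ.approx n) fun j => (a j).get i) :
    (ultraprod U F).Sat φ fun j => toUltra (a j) := by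
  have hinv : Tendsto (fun n : ℕ => (1 : ℝ) / n) atTop (𝓝 0) := tendsto_one_div_atTop_nhds_zero_nat
  induction φ with
  | normLE t r =>
    obtain ⟨g, hg, hP⟩ := exists_diagonal hU h
    simp only [PBFormula.approx, Sat] at hP ⊢
    push_cast at hP
    simpa using le_of_tendsto_of_tendsto (tendsto_norm_eval a t)
      ((hinv.comp hg).const_add (r : ℝ)) hP
  | normGE t r =>
    obtain ⟨g, hg, hP⟩ := exists_diagonal hU h
    simp only [PBFormula.approx, Sat] at hP ⊢
    push_cast at hP
    simpa using le_of_tendsto_of_tendsto ((hinv.comp hg).const_sub (r : ℝ))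
      (tendsto_norm_eval a t) hP
  | relLE R t r =>
    obtain ⟨g, hg, hP⟩ := exists_diagonal hU h
    simp only [PBFormula.approx, Sat] at hP ⊢
    push_cast at hP
    simpa using le_of_tendsto_of_tendsto (tendsto_rel_eval a R t)
      ((hinv.comp hg).const_add (r : ℝ)) hP
  | relGE R t r =>
    obtain ⟨g, hg, hP⟩ := exists_diagonal hU h
    simp only [PBFormula.approx, Sat] at hP ⊢
    push_cast at hP
    simpa using le_of_tendsto_of_tendsto ((hinv.comp hg).const_sub (r : ℝ))
      (tendsto_rel_eval a R t) hP
  | and φ ψ hφ hψ =>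
    exact ⟨hφ hφ0.1 a fun n hn => (h n hn).mono fun i hi => hi.1,
      hψ hφ0.2 a fun n hn => (h n hn).mono fun i hi => hi.2⟩
  | or φ ψ hφ hψ =>
    -- If each disjunct fails at some index, the larger index contradicts both failures by
    -- monotonicity.
    by_contra hcon
    obtain ⟨h1, h2⟩ := not_or.1 hcon
    obtain ⟨m, hm, hm'⟩ : ∃ m, 0 < m ∧ ¬ ∀ᶠ i in U, (F i).Sat (φ.approx m) _ := by
      simpa using mt (hφ hφ0.1 a) h1
    obtain ⟨n, hn, hn'⟩ : ∃ n, 0 < n ∧ ¬ ∀ᶠ i in U, (F i).Sat (ψ.approx n) _ := by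
      simpa using mt (hψ hφ0.2 a) h2
    rcases Ultrafilter.eventually_or.1 (h (max m n) (lt_max_of_lt_left hm)) with h3 | h3
    · exact hm' (h3.mono fun i hi => sat_approx_mono _ hm (le_max_left _ _) _ _ hi)
    · exact hn' (h3.mono fun i hi => sat_approx_mono _ hn (le_max_right _ _) _ _ hi)
  | iAnd φ hφ =>
    refine fun l => hφ l (hφ0 l) a fun n hn => ?_
    -- Conjuncts are numbered from 0, so index `l + 1` is the first whose truncation retains `φ l`.
    filter_upwards [h (max n (l + 1)) (lt_max_of_lt_left hn)] with i hi
    simp only [PBFormula.approx, sat_finAnd] at hi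
    exact sat_approx_mono _ hn (le_max_left _ (l + 1)) _ _ (hi l (by omega))
  | ex r φ hφ =>
    obtain ⟨g, hg, hP⟩ := exists_diagonal hU h
    -- The constant `r + 1` only ensures boundedness; the sharp bound `r + 1 / g i` is carried
    -- inside `P` and yields `r` in the limit.
    obtain ⟨b, hb⟩ := exists_forall_eventually (C := (r : ℝ) + 1)
      (P := fun i y => ‖y‖ ≤ (r : ℝ) + 1 / g i ∧
        (F i).Sat (φ.approx (g i)) (Matrix.vecCons y fun j => (a j).get i)) <| by
      filter_upwards [hP, hg.eventually_ge_atTop 1] with i ⟨y, hy, hsat⟩ hgi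
      push_cast at hy
      have h1 : (1 : ℝ) / g i ≤ 1 := by
        simpa using one_div_le_one_div_of_le one_pos (by exact_mod_cast hgi : (1 : ℝ) ≤ g i)
      exact ⟨y, by linarith, hy, hsat⟩
    refine ⟨toUltra b, (norm_toUltra b).trans_le ?_, ?_⟩
    · simpa using le_of_tendsto_of_tendsto b.tendsto_norm ((hinv.comp hg).const_add (r : ℝ))
        (hb.mono fun i hi => hi.2.1)
    · rw [← map_vecCons toUltra]
      refine hφ hφ0 _ fun n hn => ?_
      filter_upwards [hb, hg.eventually_ge_atTop n] with i hi hgi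
      rw [map_vecCons fun b : BddSeq U F => b.get i]
      exact sat_approx_mono _ hn hgi _ _ hi.2.2
  | all r φ hφ =>
    intro y hy
    -- Positivity of `r` makes the shrunken radii `r - 1 / g i` eventually nonnegative; for `r = 0`
    -- they would be negative and the approximated quantifiers vacuous.
    have hr : (0 : ℝ) < r :=
      lt_of_le_of_ne ((norm_nonneg y).trans hy) (by exact_mod_cast hφ0.1.symm)
    obtain ⟨g, hg, hP⟩ := exists_diagonal hU h
    obtain ⟨c, rfl⟩ := exists_toUltra y
    have hlim : Tendsto (fun i => (r : ℝ) - 1 / g i) U (𝓝 r) := by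
      simpa using (hinv.comp hg).const_sub (r : ℝ)
    have hnonneg : ∀ᶠ i in U, 0 ≤ (r : ℝ) - 1 / g i := hlim.eventually_const_le hr
    obtain ⟨b, hbc, hb⟩ := exists_cls_eq_norm_le c hnonneg hlim (by rwa [← norm_toUltra])
    change toUltra b = toUltra c at hbc
    rw [← hbc, ← map_vecCons toUltra]
    refine hφ hφ0.2 _ fun n hn => ?_
    filter_upwards [hP, hnonneg, hg.eventually_ge_atTop n] with i hi hi0 hgi
    rw [map_vecCons fun b : BddSeq U F => b.get i]
    refine sat_approx_mono _ hn hgi _ _ (hi _ ?_)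
    push_cast
    exact hb i hi0

end NStructure

/-! ### The compactness argument -/

open NStructure in
theorem mainTheorem3 (Ω : NSignature.{u}) (T : Set (PBSentence Ω)) (σ θ : PBSentence Ω)
    (hσ : σ.UnivBoundsNeZero) (h : EntailsImp.{u, v} T σ θ) :
    ∀ n : ℕ, 0 < n → ∃ m : ℕ, 0 < m ∧ EntailsImp.{u, v} T (σ.approx m) (θ.approx n) := by
  intro n hn
  by_contra! hcon
  have key : ∀ i : ℕ, ∃ E : NStructure.{u, v} Ω, E.IsModel T ∧ E.Holds (σ.approx (i + 1)) ∧
      ¬ E.Holds (θ.approx n) := fun i => by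
    have := hcon (i + 1) i.succ_pos
    simp only [EntailsImp, not_forall, not_not] at this
    obtain ⟨E, hE, hE'⟩ := this
    exact ⟨E, hE, hE'⟩
  choose F hT hF hθ using key
  let U : Ultrafilter ℕ := hyperfilter ℕ
  have hU : (U : Filter ℕ) ≤ atTop := Nat.hyperfilter_le_atTop
  let a : Fin 0 → BddSeq U F := Fin.elim0
  have ha : ∀ i, (fun j => (a j).get i) = ![] := fun i => Subsingleton.elim _ _
  have ha' : (fun j => toUltra (a j)) = ![] := Subsingleton.elim _ _
  have hmodel : (ultraprod U F).IsModel T := fun φ hφ => by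
    have := sat_ultraprod_of_eventually_sat φ a
      (Eventually.of_forall fun i => by rw [ha]; exact hT i φ hφ)
    rwa [ha'] at this
  refine h (ultraprod U F) hmodel ⟨?_, fun hsat => ?_⟩
  · have := sat_ultraprod_of_eventually_sat_approx hU σ hσ a fun m hm => by
      -- For `i ≥ m` the sentence `σ.approx (i + 1)` is stronger than `σ.approx m`; nonprincipality
      -- makes these `i` almost all.
      filter_upwards [hU (eventually_ge_atTop m)] with i hi
      rw [ha]
      exact sat_approx_mono _ hm (Nat.le_succ_of_le hi) σ _ (hF i)
    rwa [ha'] at this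
  · obtain ⟨i, hi⟩ := (eventually_sat_approx_of_sat_ultraprod hn θ a (by rwa [ha'])).exists
    rw [ha] at hi
    exact hθ i hi
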